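/- Let $G=(V,E)$ be a finite undirected graph (loops and multiple edges allowed) and let $A,B\subseteq V^2$ be arbitrary sets of ordered pairs of vertices. An orientation of $G$ chooses one of the two directions of every edge (loops also have two directions). A subgraph of $G$ is a graph $(V,F)$ with $F\subseteq E$; it is a forest if it contains no cycle (a loop is a cycle). For an orientation $\omega$ (resp. a subgraph $(V,F)$) let $\vec G$ be the digraph on $V$ formed by the arcs of $\omega$ (resp. by two opposite arcs for every edge in $F$) together with the pairs in $A$ and in $B$ as additional arcs. The orientation (resp. subgraph) is *$(A,B)$-valid* if (a) for all $(u,v)\in A$, $v$ cannot reach $u$ by a directed path of $\vec G$, and (b) for all $(u,v)\in B$, $v$ can reach $u$ by a directed path of $\vec G$ (a vertex reaches itself by the path of length $0$). An *$(A,B)$-cocycle* of an orientation $\omega$ is a non-empty set of arcs of $\vec G$, none of them from $A\cup B$, which for some partition $V=V_1\cup V_2$ is the set of all arcs of $\vec G$ from $V_1$ to $V_2$, where $\vec G$ has no arc from $V_2$ to $V_1$. Two orientations are *cycle* (resp. *cocycle*, *cycle-cocycle*) *equivalent* if one is obtained from the other by repeatedly reversing all the edges of a directed cycle of the current orientation (resp.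 of an $(A,B)$-cocycle, of a directed cycle or an $(A,B)$-cocycle). A subgraph $(V,F)$ is *$(A,B)$-connected* if adding the edges $\{u,v\}$, $(u,v)\in A\cup B$, to $(V,F)$ and to $G$ yields two graphs with the same connected components. Then: (i) the number of cycle equivalence classes of $(A,B)$-valid orientations of $G$ equals the number of $(A,B)$-valid forests of $G$; (ii) the number of cocycle equivalence classes of $(A,B)$-valid orientations of $G$ equals the number of $(A,B)$-valid $(A,B)$-connected subgraphs of $G$; (iii) the number of cycle-cocycle equivalence classes of $(A,B)$-valid orientations of $G$ equals the number of $(A,B)$-valid $(A,B)$-connected forests of $G$. In particular, for $A=B=\emptyset$: the number of cycle equivalence classes of orientations of $G$ equals the number of forests of $G$; and, if $G$ is connected, the number of cocycle (resp. cycle-cocycle) equivalence classes of orientations of $G$ equals the number of connected subgraphs (resp. spanning trees) of $G$. -/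

import Mathlib

open scoped Graph

namespace Graph

variable {α β : Type*} {G : Graph α β}

/-- A conventional orientation of a multigraph: for every edge, a choice of which of its two ends is
called the tail and which the head. It only serves to name the two directions of an edge (in
particular, a loop has two directions as well). -/
structure RefOrientation (G : Graph α β) where
  /-- the conventional tail of an edge -/
  tail : E(G) → V(G)
  /-- the conventional head of an edge -/
  head : E(G) → V(G)
  isLink : ∀ e : E(G), G.IsLink e (tail e) (head e)

/-- Every multigraph has a conventional orientation. -/
instance : Nonempty (RefOrientation G) := by
  have h : ∀ e : E(G), ∃ p : V(G) × V(G), G.IsLink e p.1 p.2 := by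
    rintro ⟨e, he⟩
    obtain ⟨x, y, hxy⟩ := exists_isLink_of_mem_edgeSet he
    exact ⟨(⟨x, hxy.left_mem⟩, ⟨y, hxy.right_mem⟩), hxy⟩
  choose p hp using h
  exact ⟨⟨fun e => (p e).1, fun e => (p e).2, hp⟩⟩

/-- An arc of `G`: an edge with one of its two directions, `true` being the conventional one. -/
abbrev Arc (G : Graph α β) := E(G) × Bool

/-- An orientation of `G`: one direction for every edge (so there are `2 ^ |E(G)|` of them). -/
abbrev Orientation (G : Graph α β) := E(G) → Bool

/-- The arcs of an orientation. -/
def orientationArcs (ω : G.Orientation) : Set G.Arc := {a | ω a.1 = a.2}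

/-- The arcs of the subgraph `(V(G), F)`, each edge being replaced by two opposite arcs. -/
def subgraphArcs (F : Set E(G)) : Set G.Arc := {a | a.1 ∈ F}

open Classical in
/-- The orientation obtained from `ω` by reversing the edges in `X`. -/
noncomputable def reverse (ω : G.Orientation) (X : Set E(G)) : G.Orientation :=
  fun e => if e ∈ X then !(ω e) else ω e

/-- `u` and `v` are adjacent in the undirected graph obtained from the subgraph `(V(G), F)` by
adding an edge `{x, y}` for every pair `(x, y)` in `A ∪ B`. -/
def AdjAdd (A B : Set (V(G) × V(G))) (F : Set E(G)) (u v : V(G)) : Prop :=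
  (∃ e ∈ F, G.IsLink e u v) ∨ (u, v) ∈ A ∪ B ∨ (v, u) ∈ A ∪ B

/-- The subgraph `(V(G), F)` is `(A, B)`-connected: adding the edges of `A ∪ B` to it and to `G`
gives two graphs with the same connected components. -/
def IsABConnected (A B : Set (V(G) × V(G))) (F : Set E(G)) : Prop :=
  ∀ u v : V(G), Relation.ReflTransGen (AdjAdd A B F) u v ↔
    Relation.ReflTransGen (AdjAdd A B Set.univ) u v

/-- The subgraph `(V(G), F)` is connected (in the ordinary sense). -/
def IsConnectedSubgraph (F : Set E(G)) : Prop :=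
  Nonempty V(G) ∧
    ∀ u v : V(G), Relation.ReflTransGen (fun x y : V(G) => ∃ e ∈ F, G.IsLink e x y) u v

namespace RefOrientation

variable (o : G.RefOrientation)

/-- The initial vertex of an arc. -/
def src (a : G.Arc) : V(G) := if a.2 then o.tail a.1 else o.head a.1

/-- The terminal vertex of an arc. -/
def tgt (a : G.Arc) : V(G) := if a.2 then o.head a.1 else o.tail a.1

/-- There is an arc from `u` to `v` in the digraph with arc set `D` together with the pairs in `A`
and `B` as additional arcs. -/
def Step (A B : Set (V(G) × V(G))) (D : Set G.Arc) (u v : V(G)) : Prop :=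
  (∃ a ∈ D, o.src a = u ∧ o.tgt a = v) ∨ (u, v) ∈ A ∨ (u, v) ∈ B

/-- `u` can reach `v` by a directed path in that digraph. -/
def Reach (A B : Set (V(G) × V(G))) (D : Set G.Arc) : V(G) → V(G) → Prop :=
  Relation.ReflTransGen (o.Step A B D)

/-- The digraph with arc set `D` is `(A, B)`-valid: the head of a pair in `A` can never reach its
tail, and the head of a pair in `B` can always reach its tail. -/
def IsValid (A B : Set (V(G) × V(G))) (D : Set G.Arc) : Prop :=
  (∀ u v, (u, v) ∈ A → ¬ o.Reach A B D v u) ∧ (∀ u v, (u, v) ∈ B → o.Reach A B D v u)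

/-- The cyclic sequence of arcs `c 0, …, c n` traverses a cycle of `G`: consecutive arcs match
(cyclically), and no vertex and no edge is repeated. Loops are the cycles of length one. -/
def IsCycle {n : ℕ} (c : Fin (n + 1) → G.Arc) : Prop :=
  (∀ i, o.tgt (c i) = o.src (c (i + 1))) ∧
    Function.Injective (fun i => o.src (c i)) ∧ Function.Injective (fun i => (c i).1)

/-- The subgraph `(V(G), F)` is a forest: it contains no cycle of `G`. -/
def IsForest (F : Set E(G)) : Prop :=
  ¬ ∃ (n : ℕ) (c : Fin (n + 1) → G.Arc), o.IsCycle c ∧ ∀ i, (c i).1 ∈ F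

/-- `X` is the edge set of a directed cycle of the orientation `ω`. -/
def IsDirectedCycle (ω : G.Orientation) (X : Set E(G)) : Prop :=
  ∃ (n : ℕ) (c : Fin (n + 1) → G.Arc), o.IsCycle c ∧ (∀ i, c i ∈ orientationArcs ω) ∧
    X = Set.range (fun i => (c i).1)

/-- `X` is the edge set of an `(A, B)`-cocycle of the orientation `ω`: there is a partition
`V(G) = U ∪ Uᶜ` such that the digraph obtained from `ω` by adding the arcs in `A` and `B` has no
arc from `Uᶜ` to `U`, its set of arcs from `U` to `Uᶜ` is not empty and contains no arc of `A` or
`B`, and `X` is the set of edges of `G` underlying that set of arcs. -/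
def IsABCocycle (A B : Set (V(G) × V(G))) (ω : G.Orientation) (X : Set E(G)) : Prop :=
  X.Nonempty ∧ ∃ U : Set V(G),
    X = {e | ∃ a ∈ orientationArcs ω, a.1 = e ∧ o.src a ∈ U ∧ o.tgt a ∉ U} ∧
    (∀ a ∈ orientationArcs ω, ¬ (o.src a ∉ U ∧ o.tgt a ∈ U)) ∧
    (∀ p ∈ A ∪ B, ¬ (p.1 ∉ U ∧ p.2 ∈ U)) ∧
    (∀ p ∈ A ∪ B, ¬ (p.1 ∈ U ∧ p.2 ∉ U))

/-- `ω'` is obtained from `ω` by reversing one directed cycle. -/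
def CycleReversal (ω ω' : G.Orientation) : Prop :=
  ∃ X, o.IsDirectedCycle ω X ∧ ω' = reverse ω X

/-- `ω'` is obtained from `ω` by reversing one `(A, B)`-cocycle. -/
def CocycleReversal (A B : Set (V(G) × V(G))) (ω ω' : G.Orientation) : Prop :=
  ∃ X, o.IsABCocycle A B ω X ∧ ω' = reverse ω X

/-- `ω'` is obtained from `ω` by reversing one directed cycle or one `(A, B)`-cocycle. -/
def CycleCocycleReversal (A B : Set (V(G) × V(G))) (ω ω' : G.Orientation) : Prop :=
  o.CycleReversal ω ω' ∨ o.CocycleReversal A B ω ω'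

theorem reverse_reverse (ω : G.Orientation) (X : Set E(G)) :
    reverse (reverse ω X) X = ω := by
  funext e
  by_cases h : e ∈ X <;> simp [reverse, h]

theorem cycleReversal_symm {ω ω' : G.Orientation} (h : o.CycleReversal ω ω') :
    o.CycleReversal ω' ω := by
  obtain ⟨X, ⟨n, c, ⟨h1, h2, h3⟩, h4, rfl⟩, rfl⟩ := h
  have hs : ∀ a : G.Arc, o.src (a.1, !a.2) = o.tgt a := by
    rintro ⟨e, _ | _⟩ <;> simp [src, tgt]
  have ht : ∀ a : G.Arc, o.tgt (a.1, !a.2) = o.src a := by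
    rintro ⟨e, _ | _⟩ <;> simp [src, tgt]
  refine ⟨_, ⟨n, fun i => ((c (-i)).1, !(c (-i)).2), ⟨?_, ?_, ?_⟩, ?_, ?_⟩,
    (reverse_reverse _ _).symm⟩
  · intro i
    rw [ht, hs, h1]
    congr 2
    abel
  · intro i j hij
    simp only [hs, h1] at hij
    simpa using h2 hij
  · intro i j hij
    simpa using h3 hij
  · intro i
    have := h4 (-i)
    simp only [orientationArcs, Set.mem_ofPred_eq] at this ⊢
    simp [reverse, this]
  · ext e
    constructor
    · rintro ⟨i, rfl⟩
      exact ⟨-i, by simp⟩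
    · rintro ⟨i, rfl⟩
      exact ⟨-i, rfl⟩

theorem cocycleReversal_symm (A B : Set (V(G) × V(G))) {ω ω' : G.Orientation}
    (h : o.CocycleReversal A B ω ω') : o.CocycleReversal A B ω' ω := by
  obtain ⟨X, ⟨hX, U, hU, h1, h2, h3⟩, rfl⟩ := h
  have hs : ∀ e b, o.src (e, !b) = o.tgt (e, b) := by
    rintro e (_ | _) <;> simp [src, tgt]
  have ht : ∀ e b, o.tgt (e, !b) = o.src (e, b) := by
    rintro e (_ | _) <;> simp [src, tgt]
  have hm : ∀ e, e ∈ X ↔ o.src (e, ω e) ∈ U ∧ o.tgt (e, ω e) ∉ U := by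
    intro e
    rw [hU]
    constructor
    · rintro ⟨⟨e', b⟩, hb, rfl, h⟩
      have hb : ω e' = b := hb
      subst hb
      exact h
    · exact fun h => ⟨(e, ω e), rfl, rfl, h⟩
  have hn : ∀ e, ¬ (o.src (e, ω e) ∉ U ∧ o.tgt (e, ω e) ∈ U) := fun e => h1 (e, ω e) rfl
  refine ⟨X, ⟨hX, Uᶜ, ?_, ?_, ?_, ?_⟩, (reverse_reverse _ _).symm⟩
  · ext e
    constructor
    · intro he
      refine ⟨(e, reverse ω X e), rfl, rfl, ?_⟩
      have := (hm e).1 he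
      simp only [reverse, he, if_true, hs, ht, Set.mem_compl_iff, not_not]
      exact ⟨this.2, this.1⟩
    · rintro ⟨⟨e', b⟩, hb, rfl, h⟩
      have hb : reverse ω X e' = b := hb
      subst hb
      by_contra he
      simp only [reverse, he, if_false, Set.mem_compl_iff, not_not] at h
      exact hn _ h
  · rintro ⟨e, b⟩ hb h
    have hb : reverse ω X e = b := hb
    subst hb
    by_cases he : e ∈ X
    · simp only [reverse, he, if_true, hs, ht, Set.mem_compl_iff, not_not] at h
      exact hn _ ⟨h.2, h.1⟩
    · simp only [reverse, he, if_false, Set.mem_compl_iff, not_not] at h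
      exact he ((hm e).2 h)
  · intro p hp h
    simp only [Set.mem_compl_iff, not_not] at h
    exact h3 p hp h
  · intro p hp h
    simp only [Set.mem_compl_iff, not_not] at h
    exact h2 p hp h

/-- The equivalence relation whose classes are reached by repeating a symmetric elementary move. -/
def repeated {X : Type*} (r : X → X → Prop) (hr : ∀ {x y}, r x y → r y x) : Setoid X where
  r := Relation.ReflTransGen r
  iseqv := ⟨fun _ => .refl, fun h => by
    induction h with
    | refl => exact .refl
    | tail _ hyz ih => exact .head (hr hyz) ih, fun h h' => h.trans h'⟩

/-- Cycle equivalence: one orientation is obtained from the other by repeatedly reversing directed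
cycles. -/
def cycleEquiv : Setoid G.Orientation :=
  repeated o.CycleReversal o.cycleReversal_symm

/-- Cocycle equivalence: one orientation is obtained from the other by repeatedly reversing
`(A, B)`-cocycles. -/
def cocycleEquiv (A B : Set (V(G) × V(G))) : Setoid G.Orientation :=
  repeated (o.CocycleReversal A B) (o.cocycleReversal_symm A B)

/-- Cycle-cocycle equivalence: one orientation is obtained from the other by repeatedly reversing
directed cycles and/or `(A, B)`-cocycles. -/
def cycleCocycleEquiv (A B : Set (V(G) × V(G))) : Setoid G.Orientation :=
  repeated (o.CycleCocycleReversal A B)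
    (fun h => h.imp o.cycleReversal_symm (o.cocycleReversal_symm A B))

/-- The `(A, B)`-valid orientations of `G`. -/
abbrev ValidOrientation (A B : Set (V(G) × V(G))) :=
  {ω : G.Orientation // o.IsValid A B (orientationArcs ω)}

/-- The number of equivalence classes of `(A, B)`-valid orientations under an equivalence relation
between orientations. -/
noncomputable def numValidClasses (A B : Set (V(G) × V(G))) (s : Setoid G.Orientation) : ℕ :=
  Nat.card (Quotient (s.comap (Subtype.val : o.ValidOrientation A B → G.Orientation)))

end RefOrientation

end Graph

/-! Fix an injective ranking of the edges. Call an orientation reduced if the least edge of every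
directed cycle and/or every `(A, B)`-cocycle (according to the moves allowed) has its conventional
direction. Phrased through reachability, this makes sense for any set of arcs; for a subgraph, with
both arcs of each edge, it says "forest" and/or "`(A, B)`-connected". The theorem thus splits into
two claims.

Each class of valid orientations has exactly one reduced member. Reversals preserve validity, and a
lexicographically extremal member of a class is reduced. For uniqueness, the difference of two
equivalent orientations is a circulation plus a coboundary. Because its values lie in {-1, 0, 1},
the two summands have disjoint supports, so at the first edge of disagreement exactly one of them is
nonzero, and either case contradicts reducedness.

Valid reduced orientations and valid reduced subgraphs are equinumerous. In order of increasing
rank, edges carrying both or no arcs are turned into edges carrying exactly one. By `exists_toggle`,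
the rest of the digraph determines an arc of the current edge whose presence is irrelevant. Toggling
it exchanges "none" with that arc alone and "both" with the opposite arc alone, which is a
bijection. Such an arc exists because the digraphs that matter form a chain under inclusion. -/

namespace Graph

open Relation

/-! ### Reachability after adding arcs -/

section Reachability

variable {V : Type*} {R R₁ R₂ : V → V → Prop}

theorem reflTransGen_mono {x y : V} (h : ∀ a b, R a b → R₁ a b) (hxy : ReflTransGen R x y) :
    ReflTransGen R₁ x y :=
  ReflTransGen.mono h x y hxy

/-- An arc into the starting vertex is useless: a walk can be restarted after its last use. -/
theorem reflTransGen_of_add_arc {x y z : V} (h : ∀ a b, R₁ a b → R a b ∨ a = x ∧ b = y)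
    (hz : ReflTransGen R₁ y z) : ReflTransGen R y z := by
  induction hz with
  | refl => exact .refl
  | tail _ hbc ih =>
    rcases h _ _ hbc with h | ⟨rfl, rfl⟩
    · exact ih.tail h
    · exact .refl

/-- Cut the walk before its first and after its last use of a new arc. -/
theorem reflTransGen_add_two_arcs {u v y z : V}
    (h : ∀ a b, R₁ a b → R a b ∨ a = u ∧ b = v ∨ a = v ∧ b = u) (hz : ReflTransGen R₁ y z) :
    ReflTransGen R y z ∨ (ReflTransGen R y u ∨ ReflTransGen R y v) ∧
      (ReflTransGen R u z ∨ ReflTransGen R v z) := by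
  induction hz with
  | refl => exact .inl .refl
  | tail _ hbc ih =>
    rcases h _ _ hbc with h | ⟨rfl, rfl⟩ | ⟨rfl, rfl⟩
    · exact ih.imp (·.tail h) (And.imp_right (Or.imp (·.tail h) (·.tail h)))
    · exact .inr ⟨ih.elim .inl (·.1), .inr .refl⟩
    · exact .inr ⟨ih.elim .inr (·.1), .inl .refl⟩

/-- If `s` is reachable from `t` only when `t` is reachable from `s`, then adding an arc from `s`
to `t` (possibly besides one from `t` to `s`) does not change whether an arc of the original digraph
lies on a closed walk. -/
theorem reflTransGen_add_arc_iff {s t x y : V} (h₀ : ∀ a b, R a b → R₁ a b)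
    (h₁ : ∀ a b, R₁ a b → R a b ∨ a = t ∧ b = s) (h₁₂ : ∀ a b, R₁ a b → R₂ a b)
    (h₂ : ∀ a b, R₂ a b → R₁ a b ∨ a = s ∧ b = t)
    (hst : ReflTransGen R t s → ReflTransGen R s t) (hxy : R x y) :
    ReflTransGen R₂ y x ↔ ReflTransGen R₁ y x := by
  refine ⟨fun h => ?_, reflTransGen_mono h₁₂⟩
  by_cases hs : ReflTransGen R s t
  · have hs₁ : ReflTransGen R₁ s t := reflTransGen_mono h₀ hs
    clear hxy
    induction h with
    | refl => exact .refl
    | tail _ hbc ih =>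
      rcases h₂ _ _ hbc with h | ⟨rfl, rfl⟩
      · exact ih.tail h
      · exact ih.trans hs₁
  -- Now neither of `s`, `t` reaches the other in `R`. If the walk enters the new arcs at one of
  -- them and leaves them at the other, the arc from `x` to `y` joins the two outer pieces into an
  -- `R`-walk between `s` and `t`, which is impossible. If both are the same vertex, the outer
  -- pieces already join up.
  · have ht : ¬ ReflTransGen R t s := fun h => hs (hst h)
    have h' : ∀ a b, R₂ a b → R a b ∨ a = s ∧ b = t ∨ a = t ∧ b = s := fun a b hab =>
      (h₂ a b hab).elim (fun h => (h₁ a b h).imp_right .inr) (fun h => .inr (.inl h))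
    refine reflTransGen_mono h₀ ?_
    rcases reflTransGen_add_two_arcs h' h with h | ⟨h₁ | h₁, h₂ | h₂⟩
    · exact h
    · exact h₁.trans h₂
    · exact (ht ((h₂.tail hxy).trans h₁)).elim
    · exact (hs ((h₂.tail hxy).trans h₁)).elim
    · exact h₁.trans h₂

end Reachability

/-! ### Arcs whose presence does not affect validity and reducedness -/

namespace RefOrientation

variable {α β : Type*} {G : Graph α β} (o : G.RefOrientation)

theorem step_mono {A B A' B' : Set (V(G) × V(G))} {D D' : Set G.Arc} (hA : A ∪ B ⊆ A' ∪ B')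
    (hD : D ⊆ D') (u v : V(G)) (h : o.Step A B D u v) : o.Step A' B' D' u v := by
  rcases h with ⟨a, ha, h⟩ | h
  · exact .inl ⟨a, hD ha, h⟩
  · exact .inr (hA h)

theorem step_insert {A B : Set (V(G) × V(G))} {D D' : Set G.Arc} {a : G.Arc}
    (hD : ∀ d ∈ D', d ∈ D ∨ d = a) (u v : V(G)) (h : o.Step A B D' u v) :
    o.Step A B D u v ∨ u = o.src a ∧ v = o.tgt a := by
  rcases h with ⟨d, hd, rfl, rfl⟩ | h
  · rcases hD d hd with hd | rfl
    · exact .inl (.inl ⟨d, hd, rfl, rfl⟩)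
    · exact .inr ⟨rfl, rfl⟩
  · exact .inl (.inr h)

theorem src_not (e : E(G)) (b : Bool) : o.src (e, !b) = o.tgt (e, b) := by
  cases b <;> simp [src, tgt]

theorem tgt_not (e : E(G)) (b : Bool) : o.tgt (e, !b) = o.src (e, b) := by
  cases b <;> simp [src, tgt]

/-- `C` and `P` let one statement cover all levels: `P` discards edges of low rank, and `C` supplies
both arcs of every edge of low rank. -/
theorem reach_insert_iff {A B : Set (V(G) × V(G))} {C P D D' : Set G.Arc} {e : E(G)} {b : Bool}
    (hD : D ⊆ D') (hD' : ∀ a ∈ D', a ∈ D ∨ a = (e, !b))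
    (hst : o.Reach A B (C ∪ D ∩ P) (o.tgt (e, b)) (o.src (e, b)) →
      o.Reach A B (C ∪ D ∩ P) (o.src (e, b)) (o.tgt (e, b)))
    {x y : V(G)} (hxy : o.Step A B (C ∪ D ∩ P) x y) :
    o.Reach A B (C ∪ insert (e, b) D' ∩ P) y x ↔ o.Reach A B (C ∪ D' ∩ P) y x := by
  refine reflTransGen_add_arc_iff (R := o.Step A B (C ∪ D ∩ P)) (s := o.src (e, b))
    (t := o.tgt (e, b)) ?_ ?_ ?_ ?_ hst hxy
  · exact o.step_mono le_rfl (by gcongr)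
  · rw [← o.src_not e b, ← o.tgt_not e b]
    refine o.step_insert ?_
    rintro d (hd | ⟨hd, hP⟩)
    · exact .inl (.inl hd)
    · exact (hD' d hd).imp_left fun h => .inr ⟨h, hP⟩
  · exact o.step_mono le_rfl (by gcongr; exact Set.subset_insert _ _)
  · refine o.step_insert ?_
    rintro d (hd | ⟨rfl | hd, hP⟩)
    · exact .inl (.inl hd)
    · exact .inr rfl
    · exact .inl (.inr ⟨hd, hP⟩)

/-- The digraph with arc set `D` is reduced with respect to the ranking `r` of the edges.
For the arcs of an orientation: if `cyc` holds, the edge of least rank of every directed cycle has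
its conventional direction, and if `coc` holds, so has the edge of least rank of every
`(A, B)`-cocycle. -/
def IsReduced (r : E(G) → ℕ) (cyc coc : Prop) (A B : Set (V(G) × V(G))) (D : Set G.Arc) : Prop :=
  (cyc → ∀ e, (e, false) ∈ D →
    ¬ o.Reach ∅ ∅ (D ∩ {a | r e < r a.1}) (o.tail e) (o.head e)) ∧
  (coc → ∀ e, (e, true) ∉ D →
    o.Reach (A ∪ B) (Prod.swap ⁻¹' (A ∪ B)) ({a | r a.1 < r e} ∪ D) (o.tail e) (o.head e))

/-- The digraphs through which the conditions of `IsValid` and `IsReduced` depend on the edges of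
rank `k`. -/
def levels (r : E(G) → ℕ) (A B : Set (V(G) × V(G))) (D : Set G.Arc) (k : ℕ) :
    Set (V(G) → V(G) → Prop) :=
  {R | R = o.Step A B D ∨ (∃ n ≤ k, R = o.Step ∅ ∅ (D ∩ {a | n ≤ r a.1})) ∨
    ∃ n ≤ k, R = o.Step (A ∪ B) (Prod.swap ⁻¹' (A ∪ B)) ({a | r a.1 < n} ∪ D)}

/-- The chain runs from the restrictions of `D` to high ranks, through `D` with the pairs, to the
digraphs where the pairs and the edges of low rank become two-way. -/
theorem levels_total (r : E(G) → ℕ) (A B : Set (V(G) × V(G))) (D : Set G.Arc) (k : ℕ)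
    {R R' : V(G) → V(G) → Prop} (hR : R ∈ o.levels r A B D k) (hR' : R' ∈ o.levels r A B D k) :
    (∀ x y, R x y → R' x y) ∨ (∀ x y, R' x y → R x y) := by
  have hlow (n) : ∀ x y, o.Step ∅ ∅ (D ∩ {a | n ≤ r a.1}) x y → o.Step A B D x y :=
    o.step_mono (by simp) Set.inter_subset_left
  have hhigh (n) : ∀ x y, o.Step A B D x y →
      o.Step (A ∪ B) (Prod.swap ⁻¹' (A ∪ B)) ({a | r a.1 < n} ∪ D) x y :=
    o.step_mono Set.subset_union_left Set.subset_union_right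
  rcases hR with rfl | ⟨n, -, rfl⟩ | ⟨n, -, rfl⟩ <;>
    rcases hR' with rfl | ⟨n', -, rfl⟩ | ⟨n', -, rfl⟩
  · exact .inl fun _ _ h => h
  · exact .inr (hlow _)
  · exact .inl (hhigh _)
  · exact .inl (hlow _)
  · rcases le_total n n' with h | h
    · exact .inr (o.step_mono le_rfl fun a ha => ⟨ha.1, h.trans ha.2⟩)
    · exact .inl (o.step_mono le_rfl fun a ha => ⟨ha.1, h.trans ha.2⟩)
  · exact .inl fun x y h => hhigh _ _ _ (hlow _ _ _ h)
  · exact .inr (hhigh _)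
  · exact .inr fun x y h => hhigh _ _ _ (hlow _ _ _ h)
  · rcases le_total n n' with h | h
    · exact .inl (o.step_mono le_rfl fun a ha => ha.imp_left fun ha => lt_of_lt_of_le ha h)
    · exact .inr (o.step_mono le_rfl fun a ha => ha.imp_left fun ha => lt_of_lt_of_le ha h)

/-- If at some level the head reaches the tail but not conversely, then `false` works: larger levels
inherit the walk from head to tail, smaller ones have none from tail to head. Otherwise `true`
satisfies the first clause, and `false` is needed only if the tail does not reach the head in the
largest digraph, hence at no level. The last two clauses serve the reducedness condition at `e`
itself. -/
theorem exists_direction (r : E(G) → ℕ) (A B : Set (V(G) × V(G))) (D : Set G.Arc) (e : E(G)) :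
    ∃ b : Bool, (∀ R ∈ o.levels r A B D (r e), ReflTransGen R (o.tgt (e, b)) (o.src (e, b)) →
        ReflTransGen R (o.src (e, b)) (o.tgt (e, b))) ∧
      (b = true → o.Reach (A ∪ B) (Prod.swap ⁻¹' (A ∪ B)) ({a | r a.1 < r e} ∪ D)
        (o.tail e) (o.head e)) ∧
      (b = false → ¬ o.Reach ∅ ∅ (D ∩ {a | r e < r a.1}) (o.tail e) (o.head e)) := by
  set high := o.Step (A ∪ B) (Prod.swap ⁻¹' (A ∪ B)) ({a | r a.1 < r e} ∪ D) with hhigh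
  set low := o.Step ∅ ∅ (D ∩ {a | r e < r a.1}) with hlow
  have low_le : ∀ R ∈ o.levels r A B D (r e), ∀ x y, low x y → R x y := by
    rintro R (rfl | ⟨n, hn, rfl⟩ | ⟨n, hn, rfl⟩)
    · exact o.step_mono (by simp) Set.inter_subset_left
    · exact o.step_mono le_rfl fun a ha => ⟨ha.1, hn.trans ha.2.le⟩
    · exact o.step_mono (by simp) fun a ha => .inr ha.1
  have le_high : ∀ R ∈ o.levels r A B D (r e), ∀ x y, R x y → high x y := by
    rintro R (rfl | ⟨n, hn, rfl⟩ | ⟨n, hn, rfl⟩)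
    · exact o.step_mono Set.subset_union_left Set.subset_union_right
    · exact o.step_mono (by simp) fun a ha => .inr ha.1
    · exact o.step_mono le_rfl fun a ha => ha.imp_left fun ha => lt_of_lt_of_le ha hn
  by_cases h₁ : ∀ R ∈ o.levels r A B D (r e),
      ReflTransGen R (o.head e) (o.tail e) → ReflTransGen R (o.tail e) (o.head e)
  · by_cases h₂ : ReflTransGen high (o.tail e) (o.head e)
    · exact ⟨true, by simpa [src, tgt] using h₁, fun _ => h₂, by simp⟩
    · refine ⟨false, ?_, by simp, fun _ h => ?_⟩
      · intro R hR h
        exact (h₂ (reflTransGen_mono (le_high R hR) (by simpa [src, tgt] using h))).elim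
      · have hR : o.Step A B D ∈ o.levels r A B D (r e) := .inl rfl
        exact h₂ (reflTransGen_mono (fun x y h => le_high _ hR x y (low_le _ hR x y h)) h)
  · push Not at h₁
    obtain ⟨R, hR, hR₁, hR₂⟩ := h₁
    refine ⟨false, fun R' hR' h => ?_, by simp, fun _ h => hR₂ (reflTransGen_mono (low_le R hR) h)⟩
    simp only [src, tgt, Bool.false_eq_true, if_false] at h ⊢
    rcases o.levels_total r A B D _ hR hR' with hle | hle
    · exact reflTransGen_mono hle hR₁
    · exact (hR₂ (reflTransGen_mono hle h)).elim

/-- The only arc that can be added is that of `j` from head to tail, which returns to the start of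
the walk. The condition at `j` thereby concerns closed walks through this arc in a digraph
containing it, as `reach_insert_iff` requires. -/
theorem reach_above_iff {r : E(G) → ℕ} (hr : r.Injective) {D : Set G.Arc} {j : E(G)}
    (hj : (j, true) ∉ D) :
    o.Reach ∅ ∅ (D ∩ {a | r j < r a.1}) (o.tail j) (o.head j) ↔
      o.Reach ∅ ∅ (D ∩ {a | r j ≤ r a.1}) (o.tail j) (o.head j) := by
  refine ⟨reflTransGen_mono (o.step_mono le_rfl fun a ha => ⟨ha.1, Nat.le_of_lt ha.2⟩), fun h => ?_⟩
  refine reflTransGen_of_add_arc (x := o.head j) ?_ h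
  have := o.step_insert (A := ∅) (B := ∅) (D := D ∩ {a | r j < r a.1})
    (D' := D ∩ {a | r j ≤ r a.1}) (a := (j, false)) ?_
  · simpa [src, tgt] using this
  · rintro ⟨i, b⟩ ⟨hd, hle⟩
    rcases lt_or_eq_of_le (show r j ≤ r i from hle) with h | h
    · exact .inl ⟨hd, h⟩
    · obtain rfl := hr h
      cases b
      · exact .inr rfl
      · exact (hj hd).elim

/-- Adding a suitable one of the two arcs of an edge `e` changes neither validity nor reducedness,
as long as every edge of smaller rank has exactly one direction. The choice of the arc does not
depend on the arcs of `e` already present. -/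
theorem exists_toggle {r : E(G) → ℕ} (hr : r.Injective) (cyc coc : Prop)
    (A B : Set (V(G) × V(G))) (e : E(G)) (D : Set G.Arc) (hDe : ∀ a ∈ D, a.1 ≠ e)
    (hlt : ∀ j, r j < r e → ((j, false) ∈ D ↔ (j, true) ∉ D)) :
    ∃ b : Bool, ∀ D' : Set G.Arc, (∀ a : G.Arc, a.1 ≠ e → (a ∈ D' ↔ a ∈ D)) → (e, b) ∉ D' →
      (o.IsValid A B (insert (e, b) D') ∧ o.IsReduced r cyc coc A B (insert (e, b) D') ↔
        o.IsValid A B D' ∧ o.IsReduced r cyc coc A B D') := by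
  obtain ⟨b, hb, hb₁, hb₂⟩ := o.exists_direction r A B D e
  refine ⟨b, fun D' hD' heb => ?_⟩
  have hsub : D ⊆ D' := fun a ha => (hD' a (hDe a ha)).2 ha
  have hsup : ∀ a ∈ D', a ∈ D ∨ a = (e, !b) := by
    rintro ⟨j, c⟩ ha
    by_cases hj : j = e
    · subst hj
      refine .inr (congrArg _ ?_)
      rcases Bool.eq_or_eq_not c b with rfl | h
      · exact (heb ha).elim
      · exact h
    · exact .inl ((hD' _ hj).1 ha)
  have hvalid : ∀ u v, (u, v) ∈ A ∨ (u, v) ∈ B →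
      (o.Reach A B (insert (e, b) D') v u ↔ o.Reach A B D' v u) := by
    intro u v huv
    have := o.reach_insert_iff (A := A) (B := B) (C := ∅) (P := Set.univ) hsub hsup
      (by simpa [Reach] using hb _ (.inl rfl)) (x := u) (y := v) (.inr huv)
    simpa using this
  have hmem : ∀ j c, j ≠ e → ((j, c) ∈ insert (e, b) D' ↔ (j, c) ∈ D') := by
    intro j c hj
    simp [hj]
  have hcyc : ∀ j, ((j, false) ∈ insert (e, b) D' →
      ¬ o.Reach ∅ ∅ (insert (e, b) D' ∩ {a | r j < r a.1}) (o.tail j) (o.head j)) ↔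
      ((j, false) ∈ D' → ¬ o.Reach ∅ ∅ (D' ∩ {a | r j < r a.1}) (o.tail j) (o.head j)) := by
    intro j
    rcases lt_or_ge (r j) (r e) with hj | hj
    · have hje : j ≠ e := by rintro rfl; exact hj.false
      rw [hmem j _ hje]
      refine imp_congr_right fun hjD => not_congr ?_
      have hjt : (j, true) ∉ D := (hlt j hj).1 ((hD' _ hje).1 hjD)
      have hjt' : (j, true) ∉ D' := fun h => hjt ((hD' _ hje).1 h)
      rw [o.reach_above_iff hr (mt (hmem j _ hje).1 hjt'), o.reach_above_iff hr hjt']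
      have := o.reach_insert_iff (A := ∅) (B := ∅) (C := ∅) (P := {a | r j ≤ r a.1}) hsub hsup
        (by simpa [Reach] using hb _ (.inr (.inl ⟨r j, hj.le, rfl⟩))) (x := o.head j) (y := o.tail j)
        (.inl ⟨(j, false), by simpa using (hD' _ hje).1 hjD, by simp [src], by simp [tgt]⟩)
      simpa using this
    · have heq : insert (e, b) D' ∩ {a | r j < r a.1} = D' ∩ {a | r j < r a.1} := by
        rw [Set.insert_inter_of_notMem]
        simpa using hj
      rw [heq]
      by_cases hje : j = e
      -- If `b` is `false`, the condition at `e` holds on both sides by the choice of `b`; if `b` is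
      -- `true`, the arc `(e, false)` is untouched.
      · subst hje
        cases b
        · have hn : ¬ o.Reach ∅ ∅ (D' ∩ {a | r j < r a.1}) (o.tail j) (o.head j) := by
            refine fun h => hb₂ rfl (reflTransGen_mono (o.step_mono le_rfl ?_) h)
            rintro a ⟨ha, hra⟩
            refine ⟨(hD' a ?_).1 ha, hra⟩
            rintro rfl
            exact Nat.lt_irrefl _ hra
          simp [hn]
        · simp
      · rw [hmem j _ hje]
  have hcoc : ∀ j, ((j, true) ∉ insert (e, b) D' →
      o.Reach (A ∪ B) (Prod.swap ⁻¹' (A ∪ B)) ({a | r a.1 < r j} ∪ insert (e, b) D')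
        (o.tail j) (o.head j)) ↔
      ((j, true) ∉ D' →
        o.Reach (A ∪ B) (Prod.swap ⁻¹' (A ∪ B)) ({a | r a.1 < r j} ∪ D')
        (o.tail j) (o.head j)) := by
    intro j
    rcases lt_trichotomy (r j) (r e) with hj | hj | hj
    · have hje : j ≠ e := by rintro rfl; exact hj.false
      rw [hmem j _ hje]
      refine imp_congr_right fun hjD => ?_
      have hjf : (j, false) ∈ D := (hlt j hj).2 fun h => hjD (hsub h)
      have := o.reach_insert_iff (A := A ∪ B) (B := Prod.swap ⁻¹' (A ∪ B))
        (C := {a | r a.1 < r j}) (P := Set.univ) hsub hsup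
        (by simpa [Reach] using hb _ (.inr (.inr ⟨r j, hj.le, rfl⟩))) (x := o.head j) (y := o.tail j)
        (.inl ⟨(j, false), by simp [hjf], by simp [src], by simp [tgt]⟩)
      simpa using this
    -- If `b` is `false`, the new arc only leads back to the tail. If `b` is `true`, its insertion
    -- makes the condition vacuous, but the choice of `b` ensures it beforehand as well.
    · obtain rfl := hr hj
      cases b
      · rw [show ((j, true) ∉ insert (j, false) D' ↔ (j, true) ∉ D') by simp]
        refine imp_congr_right fun hjD => ⟨fun h => ?_,
          reflTransGen_mono (o.step_mono le_rfl (by gcongr; exact Set.subset_insert _ _))⟩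
        refine reflTransGen_of_add_arc (x := o.head j) ?_ h
        have := o.step_insert (A := A ∪ B) (B := Prod.swap ⁻¹' (A ∪ B))
          (D := {a | r a.1 < r j} ∪ D')
          (D' := {a | r a.1 < r j} ∪ insert (j, false) D') (a := (j, false)) ?_
        · simpa [src, tgt] using this
        · rintro d (hd | rfl | hd)
          · exact .inl (.inl hd)
          · exact .inr rfl
          · exact .inl (.inr hd)
      · refine iff_of_true (by simp) fun _ => ?_
        exact reflTransGen_mono (o.step_mono le_rfl (by gcongr)) (hb₁ rfl)
    · have hje : j ≠ e := by rintro rfl; exact hj.false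
      have heq : {a : G.Arc | r a.1 < r j} ∪ insert (e, b) D' = {a | r a.1 < r j} ∪ D' := by
        rw [Set.union_insert, Set.insert_eq_of_mem]
        exact .inl hj
      rw [hmem j _ hje, heq]
  refine and_congr (and_congr ?_ ?_) (and_congr ?_ ?_)
  · exact forall₃_congr fun u v h => not_congr (hvalid u v (.inl h))
  · exact forall₃_congr fun u v h => hvalid u v (.inr h)
  · exact imp_congr_right fun _ => forall_congr' hcyc
  · exact imp_congr_right fun _ => forall_congr' hcoc

/-! ### Interpolation between subgraphs and orientations -/

/-- `D` contains exactly one arc of every edge of rank less than `k`, and both or none of the arcs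
of every other edge. -/
def IsMixed (r : E(G) → ℕ) (k : ℕ) (D : Set G.Arc) : Prop :=
  ∀ j, (r j < k → ((j, false) ∈ D ↔ (j, true) ∉ D)) ∧ (k ≤ r j → ((j, false) ∈ D ↔ (j, true) ∈ D))

/-- Toggling the arc given by `exists_toggle` at the edge of rank `k` is the bijection. It is an
involution because the choice of the arc ignores the arcs of that edge. -/
theorem card_isMixed_succ {r : E(G) → ℕ} (hr : r.Injective) (cyc coc : Prop)
    (A B : Set (V(G) × V(G))) (k : ℕ) :
    Nat.card {D : Set G.Arc // IsMixed r k D ∧ o.IsValid A B D ∧ o.IsReduced r cyc coc A B D} =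
      Nat.card {D : Set G.Arc //
        IsMixed r (k + 1) D ∧ o.IsValid A B D ∧ o.IsReduced r cyc coc A B D} := by
  by_cases hk : ∃ e, r e = k
  swap
  · have : ∀ D : Set G.Arc, IsMixed r k D ↔ IsMixed r (k + 1) D := by
      refine fun D => forall_congr' fun j => ?_
      have hj : r j ≠ k := fun h => hk ⟨j, h⟩
      rw [show r j < k ↔ r j < k + 1 by lia, show k ≤ r j ↔ k + 1 ≤ r j by lia]
    simp only [this]
  obtain ⟨e, rfl⟩ := hk
  -- The hypothesis on smaller ranks comes after the choice of `b`, so that the direction is a total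
  -- function of `D`; its value elsewhere is arbitrary.
  have hex : ∀ D : Set G.Arc, ∃ b : Bool, (∀ j, r j < r e → ((j, false) ∈ D ↔ (j, true) ∉ D)) →
      ∀ D' : Set G.Arc, (∀ a : G.Arc, a.1 ≠ e → (a ∈ D' ↔ a ∈ D)) → (e, b) ∉ D' →
      (o.IsValid A B (insert (e, b) D') ∧ o.IsReduced r cyc coc A B (insert (e, b) D') ↔
        o.IsValid A B D' ∧ o.IsReduced r cyc coc A B D') := by
    intro D
    by_cases hlt : ∀ j, r j < r e → ((j, false) ∈ D ↔ (j, true) ∉ D)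
    · obtain ⟨b, hb⟩ := o.exists_toggle hr cyc coc A B e (D ∩ {a | a.1 ≠ e}) (fun a ha => ha.2) (by
        intro j hj
        have hje : j ≠ e := by rintro rfl; exact hj.false
        simpa [hje] using hlt j hj)
      exact ⟨b, fun _ D' hD' => hb D' fun a ha => by simp [hD' a ha, ha]⟩
    · exact ⟨true, fun h => (hlt h).elim⟩
  choose dir hdir using hex
  set off : Set G.Arc → Set G.Arc := fun D => {a | a ∈ D ∧ a.1 ≠ e} with hoff
  set f : Set G.Arc → Set G.Arc := fun D => {a | a ∈ D ↔ a ≠ (e, dir (off D))} with hf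
  have mem_f : ∀ D a, a ∈ f D ↔ (a ∈ D ↔ a ≠ (e, dir (off D))) := fun D a => Iff.rfl
  have mem_f_ne : ∀ D (a : G.Arc), a.1 ≠ e → (a ∈ f D ↔ a ∈ D) := by
    intro D a ha
    have : a ≠ (e, dir (off D)) := by rintro rfl; exact ha rfl
    simp [mem_f, this]
  have off_f : ∀ D, off (f D) = off D := fun D =>
    Set.ext fun a => and_congr_left fun ha => mem_f_ne D a ha
  have hinv : Function.Involutive f := by
    intro D
    ext a
    rw [mem_f, mem_f, off_f]
    tauto
  have hgood : ∀ D, (∀ j, r j < r e → ((j, false) ∈ D ↔ (j, true) ∉ D)) →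
      (o.IsValid A B D ∧ o.IsReduced r cyc coc A B D ↔
        o.IsValid A B (f D) ∧ o.IsReduced r cyc coc A B (f D)) := by
    intro D hD
    have hoffD : ∀ j, r j < r e → ((j, false) ∈ off D ↔ (j, true) ∉ off D) := by
      intro j hj
      have hje : j ≠ e := by rintro rfl; exact hj.false
      simpa [hoff, hje] using hD j hj
    by_cases hmem : (e, dir (off D)) ∈ D
    · have hins : insert (e, dir (off D)) (f D) = D := by
        ext a
        by_cases ha : a = (e, dir (off D))
        · simp [ha, hmem]
        · simp [mem_f, ha]
      have := hdir (off D) hoffD (f D) (fun a ha => by simp [mem_f_ne D a ha, hoff, ha])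
        (by simp [mem_f, hmem])
      rwa [hins] at this
    · have hins : insert (e, dir (off D)) D = f D := by
        ext a
        by_cases ha : a = (e, dir (off D))
        · simp [ha, hmem, mem_f]
        · simp [mem_f, ha]
      have := hdir (off D) hoffD D (fun a ha => by simp [hoff, ha]) hmem
      rw [hins] at this
      exact this.symm
  have hmixed : ∀ D, IsMixed r (r e) D ↔ IsMixed r (r e + 1) (f D) := by
    refine fun D => forall_congr' fun j => ?_
    rcases lt_trichotomy (r j) (r e) with hj | hj | hj
    · have hje : j ≠ e := by rintro rfl; exact hj.false
      rw [mem_f_ne D _ hje, mem_f_ne D _ hje]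
      simp [hj, show r j < r e + 1 by lia, show ¬ r e + 1 ≤ r j by lia,
        show ¬ r e ≤ r j by lia]
    · obtain rfl := hr hj
      simp only [mem_f]
      cases dir (off D)
      · simp
        tauto
      · simp
    · have hje : j ≠ e := by rintro rfl; exact hj.false
      rw [mem_f_ne D _ hje, mem_f_ne D _ hje]
      simp [hj.le, show ¬ r j < r e + 1 by lia, show r e + 1 ≤ r j by lia,
        show ¬ r j < r e by lia]
  refine Nat.card_congr (hinv.toPerm.subtypeEquiv fun D => ?_)
  change _ ↔ IsMixed r (r e + 1) (f D) ∧ o.IsValid A B (f D) ∧ o.IsReduced r cyc coc A B (f D)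
  rw [← hmixed D]
  exact and_congr_right fun h => hgood D fun j => (h j).1

/-- There are as many valid reduced orientations as valid reduced subgraphs. -/
theorem card_reduced_orientation_eq [Finite E(G)] {r : E(G) → ℕ} (hr : r.Injective)
    (cyc coc : Prop) (A B : Set (V(G) × V(G))) :
    Nat.card {ω : G.Orientation // o.IsValid A B (orientationArcs ω) ∧
        o.IsReduced r cyc coc A B (orientationArcs ω)} =
      Nat.card {F : Set E(G) // o.IsValid A B (subgraphArcs F) ∧
        o.IsReduced r cyc coc A B (subgraphArcs F)} := by
  obtain ⟨k, hk⟩ : ∃ k, ∀ e, r e < k := by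
    obtain ⟨k, hk⟩ := (Set.finite_range r).bddAbove
    exact ⟨k + 1, fun e => Nat.lt_succ_of_le (hk ⟨e, rfl⟩)⟩
  have hall : ∀ n, Nat.card {D : Set G.Arc // IsMixed r 0 D ∧ o.IsValid A B D ∧
      o.IsReduced r cyc coc A B D} = Nat.card {D : Set G.Arc // IsMixed r n D ∧
      o.IsValid A B D ∧ o.IsReduced r cyc coc A B D} := by
    intro n
    induction n with
    | zero => rfl
    | succ n ih => rw [ih, o.card_isMixed_succ hr]
  classical
  trans Nat.card {D : Set G.Arc // IsMixed r k D ∧ o.IsValid A B D ∧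
      o.IsReduced r cyc coc A B D}
  · refine Nat.card_congr ⟨fun ω => ⟨orientationArcs ω.1, fun j => ⟨fun _ => ?_, fun h => ?_⟩, ω.2⟩,
      fun D => ⟨fun e => decide ((e, true) ∈ D.1), ?_⟩, fun ω => ?_, fun D => ?_⟩
    · simp [orientationArcs]
    · exact absurd (hk j) (not_lt.2 h)
    · convert D.2.2 using 2 <;>
      · ext ⟨e, b⟩
        have := (D.2.1 e).1 (hk e)
        cases b <;> simp [orientationArcs, this]
    · ext e
      cases h : ω.1 e <;> simp [orientationArcs, h]
    · ext ⟨e, b⟩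
      have := (D.2.1 e).1 (hk e)
      cases b <;> simp [orientationArcs, this]
  · rw [← hall k]
    symm
    refine Nat.card_congr ⟨fun F => ⟨subgraphArcs F.1, fun j =>
        ⟨fun h => (Nat.not_lt_zero _ h).elim, fun _ => Iff.rfl⟩, F.2⟩,
      fun D => ⟨{e | (e, true) ∈ D.1}, ?_⟩, fun F => ?_, fun D => ?_⟩
    · convert D.2.2 using 2 <;>
      · ext ⟨e, b⟩
        have := (D.2.1 e).2 (Nat.zero_le _)
        cases b <;> simp [subgraphArcs, this]
    · ext e
      simp [subgraphArcs]
    · ext ⟨e, b⟩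
      have := (D.2.1 e).2 (Nat.zero_le _)
      cases b <;> simp [subgraphArcs, this]

end RefOrientation

/-! ### Walks, cycles and the effect of reversals on reachability -/

theorem exists_injOn_walk {V : Type*} {R : V → V → Prop} {x y : V} (h : ReflTransGen R x y) :
    ∃ (n : ℕ) (p : ℕ → V), p 0 = x ∧ p n = y ∧ (∀ i < n, R (p i) (p (i + 1))) ∧
      ∀ i ≤ n, ∀ j ≤ n, p i = p j → i = j := by
  classical
  have hex : ∃ n, ∃ p : ℕ → V, p 0 = x ∧ p n = y ∧ ∀ i < n, R (p i) (p (i + 1)) := by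
    induction h with
    | refl => exact ⟨0, fun _ => x, rfl, rfl, by simp⟩
    | @tail b c _ hbc ih =>
      obtain ⟨n, p, h0, hn, hp⟩ := ih
      refine ⟨n + 1, fun i => if i ≤ n then p i else c, by simpa using h0, by simp, fun i hi => ?_⟩
      rcases Nat.lt_succ_iff_lt_or_eq.1 hi with hi | rfl
      · simpa [hi.le, Nat.succ_le_of_lt hi] using hp i hi
      · simpa [hn] using hbc
  obtain ⟨p, h0, hn, hp⟩ := Nat.find_spec hex
  set n := Nat.find hex with hn_def
  refine ⟨n, p, h0, hn, hp, ?_⟩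
  have key : ∀ i j, i < j → j ≤ n → p i ≠ p j := by
    intro i j hij hj heq
    -- A shortest walk repeats no vertex: otherwise the stretch from `i` to `j` could be cut out.
    refine Nat.find_min hex (m := n - (j - i)) (by lia)
      ⟨fun m => if m ≤ i then p m else p (m + (j - i)), by simpa using h0, ?_, fun m hm => ?_⟩
    · dsimp only
      split_ifs with h
      · have h1 : j = n := by lia
        have h2 : n - (j - i) = i := by lia
        rw [h2, heq, h1, hn]
      · rw [show n - (j - i) + (j - i) = n by lia, hn]
    · dsimp only
      split_ifs with h1 h2 h2
      · exact hp m (by lia)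
      · obtain rfl : m = i := by lia
        rw [heq, show m + 1 + (j - m) = j + 1 by lia]
        exact hp j (by lia)
      · lia
      · rw [show m + 1 + (j - i) = m + (j - i) + 1 by lia]
        exact hp _ (by lia)
  intro i hi j hj heq
  rcases lt_trichotomy i j with h | h | h
  · exact (key i j h hj heq).elim
  · exact h
  · exact (key j i h hi heq.symm).elim

namespace RefOrientation

variable {α β : Type*} {G : Graph α β} (o : G.RefOrientation)

/-- A walk without repeated vertices is closed up by `a`, placed at the last index. -/
theorem exists_isCycle_of_reach {D : Set G.Arc} {a : G.Arc} (hD : ∀ d ∈ D, d.1 ≠ a.1)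
    (h : o.Reach ∅ ∅ D (o.tgt a) (o.src a)) :
    ∃ (n : ℕ) (c : Fin (n + 1) → G.Arc), o.IsCycle c ∧ c (Fin.last n) = a ∧
      ∀ i, c i = a ∨ c i ∈ D := by
  obtain ⟨n, p, h0, hn, hp, hinj⟩ := exists_injOn_walk h
  have hex : ∀ i, ∃ d : G.Arc, i < n → d ∈ D ∧ o.src d = p i ∧ o.tgt d = p (i + 1) := by
    intro i
    by_cases hi : i < n
    · rcases hp i hi with ⟨d, hd⟩ | hd | hd
      · exact ⟨d, fun _ => hd⟩
      · exact hd.elim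
      · exact hd.elim
    · exact ⟨a, fun h => (hi h).elim⟩
  choose g hg using hex
  set c : Fin (n + 1) → G.Arc := fun i => if (i : ℕ) < n then g i else a with hc
  have hlt : ∀ i : Fin (n + 1), (i : ℕ) < n → c i = g i := fun i hi => if_pos hi
  have hlast : c (Fin.last n) = a := by simp [hc]
  have hcase : ∀ i : Fin (n + 1), (i : ℕ) < n ∨ i = Fin.last n := fun i => by
    rcases Fin.eq_castSucc_or_eq_last i with ⟨j, rfl⟩ | h
    · exact .inl (by simp)
    · exact .inr h
  have hsrc : ∀ i : Fin (n + 1), o.src (c i) = p i := by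
    intro i
    rcases hcase i with hi | rfl
    · rw [hlt i hi, (hg i hi).2.1]
    · rw [hlast, Fin.val_last, hn]
  have hmatch : ∀ i, o.tgt (c i) = o.src (c (i + 1)) := by
    intro i
    rw [hsrc]
    rcases hcase i with hi | rfl
    · rw [hlt i hi, (hg i hi).2.2, Fin.val_add_one_of_lt (by simpa [Fin.lt_def] using hi)]
    · rw [hlast, Fin.last_add_one, Fin.val_zero, h0]
  have hsinj : Function.Injective fun i => o.src (c i) := by
    intro i j hij
    simp only [hsrc] at hij
    exact Fin.ext (hinj _ (Nat.lt_succ_iff.1 i.2) _ (Nat.lt_succ_iff.1 j.2) hij)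
  refine ⟨n, c, ⟨hmatch, hsinj, ?_⟩, hlast, ?_⟩
  · intro i j hij
    have hij : (c i).1 = (c j).1 := hij
    have hmem : ∀ k : Fin (n + 1), (k : ℕ) < n → (c k).1 ≠ a.1 := fun k hk => by
      rw [hlt k hk]; exact hD _ (hg k hk).1
    rcases hcase i with hi | rfl
    · rcases hcase j with hj | rfl
      · by_contra hne
        -- An edge repeated before index `n` is traversed both ways, so each of `i`, `j` would be
        -- the successor of the other; no wrap-around occurs below `n`.
        have hdir : (c i).2 = !(c j).2 := by
          rcases Bool.eq_or_eq_not (c i).2 (c j).2 with h | h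
          · exact (hne (hsinj (congrArg o.src (Prod.ext hij h)))).elim
          · exact h
        have hci : c i = ((c j).1, !(c j).2) := Prod.ext hij hdir
        have h1 : o.src (c i) = o.src (c (j + 1)) := by
          rw [hci, o.src_not, ← hmatch]
        have h2 : o.tgt (c i) = o.src (c j) := by
          rw [hci, o.tgt_not]
        rw [hmatch] at h2
        have h1 := congrArg Fin.val (hsinj h1)
        have h2 := congrArg Fin.val (hsinj h2)
        rw [Fin.val_add_one_of_lt (by simpa [Fin.lt_def] using hj)] at h1
        rw [Fin.val_add_one_of_lt (by simpa [Fin.lt_def] using hi)] at h2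
        lia
      · rw [hlast] at hij
        exact (hmem i hi hij).elim
    · rcases hcase j with hj | rfl
      · rw [hlast] at hij
        exact (hmem j hj hij.symm).elim
      · rfl
  · intro i
    rcases hcase i with hi | rfl
    · exact .inr (by rw [hlt i hi]; exact (hg i hi).1)
    · exact .inl hlast

theorem reach_of_isCycle {n : ℕ} {c : Fin (n + 1) → G.Arc} (hc : o.IsCycle c)
    (A B : Set (V(G) × V(G))) (i : Fin (n + 1)) :
    o.Reach A B {a | ∃ j, j ≠ i ∧ c j = a} (o.tgt (c i)) (o.src (c i)) := by
  by_contra hi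
  have key : ∀ t : ℕ, o.Reach A B {a | ∃ j, j ≠ i ∧ c j = a} (o.tgt (c i))
      (o.src (c (i + 1 + t • 1))) := by
    intro t
    induction t with
    | zero =>
      rw [hc.1 i, zero_nsmul, add_zero]
      exact .refl
    | succ t ih =>
      -- The walk may pass on from this index: were it `i`, the source of `c i` would have been
      -- reached already, contrary to assumption. After `n` steps the index is `i`.
      refine ih.tail (.inl ⟨_, ⟨i + 1 + t • 1, fun h => hi (by rwa [h] at ih), rfl⟩, rfl, ?_⟩)
      rw [hc.1, succ_nsmul, add_assoc]
  have hcard : (n + 1) • (1 : Fin (n + 1)) = 0 := by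
    simpa using card_nsmul_eq_zero (x := (1 : Fin (n + 1)))
  have := key n
  rw [add_assoc, ← succ_nsmul', hcard, add_zero] at this
  exact hi this

/-- Each reversed arc is replaced by the remainder of the directed cycle, which joins the same
vertices in the same direction. -/
theorem reach_of_cycleReversal {ω ω' : G.Orientation} (h : o.CycleReversal ω ω')
    (A B : Set (V(G) × V(G))) {x y : V(G)} (hxy : o.Reach A B (orientationArcs ω') x y) :
    o.Reach A B (orientationArcs ω) x y := by
  obtain ⟨X, ⟨n, c, hc, hω, rfl⟩, rfl⟩ := h
  refine ReflTransGen.trans_induction_on (motive := fun {x y} _ =>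
    o.Reach A B (orientationArcs ω) x y) hxy (fun _ => .refl) ?_ (fun _ _ => .trans)
  rintro x y (⟨⟨e, b⟩, hb, rfl, rfl⟩ | h)
  · by_cases he : e ∈ Set.range fun i => (c i).1
    · have hb : reverse ω _ e = b := hb
      obtain ⟨i, rfl⟩ := he
      have hi : ω (c i).1 = (c i).2 := hω i
      have hb' : b = !(c i).2 := by
        rw [← hb, ← hi]
        simp [reverse]
      rw [hb', o.src_not, o.tgt_not]
      refine reflTransGen_mono (o.step_mono le_rfl ?_) (o.reach_of_isCycle hc A B i)
      rintro _ ⟨j, -, rfl⟩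
      exact hω j
    · have hb : reverse ω _ e = b := hb
      rw [reverse, if_neg he] at hb
      exact .single (.inl ⟨(e, b), hb, rfl, rfl⟩)
  · exact .single (.inr h)

/-- Reversing an `(A, B)`-cocycle keeps the pairs of `A ∪ B` that lie on closed walks. -/
theorem reach_of_cocycleReversal {A B : Set (V(G) × V(G))} {ω ω' : G.Orientation}
    (h : o.CocycleReversal A B ω ω') {u v : V(G)} (huv : (u, v) ∈ A ∪ B)
    (hvu : o.Reach A B (orientationArcs ω) v u) : o.Reach A B (orientationArcs ω') v u := by
  obtain ⟨X, ⟨-, U, hX, hU, h₁, h₂⟩, rfl⟩ := h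
  have hmono : ∀ x y, o.Step A B (orientationArcs ω) x y → y ∈ U → x ∈ U := by
    rintro x y (⟨a, ha, rfl, rfl⟩ | h) hy
    · exact by_contra fun hx => hU a ha ⟨hx, hy⟩
    · exact by_contra fun hx => h₁ (x, y) h ⟨hx, hy⟩
  have hmono' : ∀ x y, o.Reach A B (orientationArcs ω) x y → y ∈ U → x ∈ U := by
    intro x y h
    induction h with
    | refl => exact id
    | tail _ hbc ih => exact fun hc => ih (hmono _ _ hbc hc)
  have huv' : u ∈ U ↔ v ∈ U :=
    ⟨fun hu => by_contra fun hv => h₂ (u, v) huv ⟨hu, hv⟩,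
      fun hv => by_contra fun hu => h₁ (u, v) huv ⟨hu, hv⟩⟩
  -- Since nothing enters `U` from outside, a walk between vertices on the same side never changes
  -- side, so it uses no reversed arc.
  have key : ∀ x, o.Reach A B (orientationArcs ω) v x → (x ∈ U ↔ u ∈ U) →
      o.Reach A B (orientationArcs (reverse ω X)) v x := by
    intro x h
    induction h with
    | refl => exact fun _ => .refl
    | @tail b c hb hbc ih =>
      intro hc
      have hbU : b ∈ U ↔ u ∈ U :=
        ⟨fun h => huv'.2 (hmono' _ _ hb h), fun h => hmono _ _ hbc (hc.2 h)⟩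
      refine (ih hbU).tail ?_
      rcases hbc with ⟨a, ha, rfl, rfl⟩ | h
      · refine .inl ⟨a, ?_, rfl, rfl⟩
        have haX : a.1 ∉ X := by
          rw [hX]
          rintro ⟨⟨e, d⟩, had, rfl, h⟩
          have had : ω a.1 = d := had
          have ha : ω a.1 = a.2 := ha
          obtain rfl : a.2 = d := ha.symm.trans had
          exact h.2 (hc.2 (hbU.1 h.1))
        have ha : ω a.1 = a.2 := ha
        simp [orientationArcs, reverse, haX, ha]
      · exact .inr h
  exact key u hvu Iff.rfl

/-- One reversal of a directed cycle (allowed if `cyc` holds) or of an `(A, B)`-cocycle (allowed if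
`coc` holds). -/
def Reversal (cyc coc : Prop) (A B : Set (V(G) × V(G))) (ω ω' : G.Orientation) : Prop :=
  cyc ∧ o.CycleReversal ω ω' ∨ coc ∧ o.CocycleReversal A B ω ω'

theorem reversal_symm {cyc coc : Prop} {A B : Set (V(G) × V(G))} {ω ω' : G.Orientation}
    (h : o.Reversal cyc coc A B ω ω') : o.Reversal cyc coc A B ω' ω :=
  h.imp (And.imp_right o.cycleReversal_symm) (And.imp_right (o.cocycleReversal_symm A B))

theorem reach_reversal_iff {cyc coc : Prop} {A B : Set (V(G) × V(G))} {ω ω' : G.Orientation}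
    (h : o.Reversal cyc coc A B ω ω') {u v : V(G)} (huv : (u, v) ∈ A ∪ B) :
    o.Reach A B (orientationArcs ω) v u ↔ o.Reach A B (orientationArcs ω') v u := by
  rcases h with ⟨-, h⟩ | ⟨-, h⟩
  · exact ⟨o.reach_of_cycleReversal (o.cycleReversal_symm h) A B,
      o.reach_of_cycleReversal h A B⟩
  · exact ⟨o.reach_of_cocycleReversal h huv,
      o.reach_of_cocycleReversal (o.cocycleReversal_symm A B h) huv⟩

theorem isValid_of_reversals {cyc coc : Prop} {A B : Set (V(G) × V(G))} {ω ω' : G.Orientation}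
    (h : ReflTransGen (o.Reversal cyc coc A B) ω ω') (hω : o.IsValid A B (orientationArcs ω)) :
    o.IsValid A B (orientationArcs ω') := by
  induction h with
  | refl => exact hω
  | tail _ hbc ih =>
    exact ⟨fun u v huv hr => ih.1 u v huv ((o.reach_reversal_iff hbc (.inl huv)).2 hr),
      fun u v huv => (o.reach_reversal_iff hbc (.inr huv)).1 (ih.2 u v huv)⟩

/-! ### Existence of a reduced representative -/

/-- The orientations reachable by reversals contain a reduced one. -/
theorem exists_isReduced [Finite E(G)] {r : E(G) → ℕ} (hr : r.Injective) (cyc coc : Prop)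
    (A B : Set (V(G) × V(G))) (ω : G.Orientation) :
    ∃ ω', ReflTransGen (o.Reversal cyc coc A B) ω ω' ∧
      o.IsReduced r cyc coc A B (orientationArcs ω') := by
  -- Lexicographic order by rank, with `true` counted as smaller than `false`. Reversing a set whose
  -- least edge is `false` makes the orientation smaller.
  let lt : G.Orientation → G.Orientation → Prop := fun ω₁ ω₂ =>
    ∃ e, (∀ j, r j < r e → ω₁ j = ω₂ j) ∧ ω₁ e = true ∧ ω₂ e = false
  have : IsTrans G.Orientation lt := ⟨by
    rintro a b c ⟨e, he, he₁, he₂⟩ ⟨f, hf, hf₁, hf₂⟩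
    rcases lt_trichotomy (r e) (r f) with h | h | h
    · exact ⟨e, fun j hj => (he j hj).trans (hf j (hj.trans h)), he₁, (hf e h).symm.trans he₂⟩
    · obtain rfl := hr h
      simp [he₂] at hf₁
    · exact ⟨f, fun j hj => (he j (hj.trans h)).trans (hf j hj), (he f h).trans hf₁, hf₂⟩⟩
  have : Std.Irrefl lt := ⟨by
    rintro a ⟨e, -, h₁, h₂⟩
    simp [h₁] at h₂⟩
  obtain ⟨ω', hω', hmin⟩ := (Finite.wellFounded_of_trans_of_irrefl lt).has_min
    {ω' | ReflTransGen (o.Reversal cyc coc A B) ω ω'} ⟨ω, .refl⟩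
  have hlt : ∀ (X : Set E(G)) (e : E(G)), e ∈ X → (∀ j ∈ X, r e ≤ r j) → ω' e = false →
      ¬ o.Reversal cyc coc A B ω' (reverse ω' X) := by
    intro X e he hX hω hrev
    refine hmin _ (ReflTransGen.tail hω' hrev) ⟨e, fun j hj => ?_, ?_, hω⟩
    · exact if_neg fun hjX => absurd (hX j hjX) (not_le.2 hj)
    · simp [reverse, he, hω]
  refine ⟨ω', hω', fun hcyc e he hreach => ?_, fun hcoc e he => by_contra fun hreach => ?_⟩
  · have he : ω' e = false := he
    obtain ⟨n, c, hc, hlast, hcD⟩ := o.exists_isCycle_of_reach (a := (e, false))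
      (D := orientationArcs ω' ∩ {a | r e < r a.1})
      (by rintro ⟨j, b⟩ ⟨-, hj⟩ rfl; exact Nat.lt_irrefl _ hj) (by simpa [src, tgt] using hreach)
    refine hlt (Set.range fun i => (c i).1) e ⟨Fin.last n, by simp [hlast]⟩ ?_ he
      (.inl ⟨hcyc, _, ⟨n, c, hc, fun i => ?_, rfl⟩, rfl⟩)
    · rintro _ ⟨i, rfl⟩
      rcases hcD i with h | h
      · simp [h]
      · exact Nat.le_of_lt h.2
    · rcases hcD i with h | h
      · rw [h]; exact he
      · exact h.1
  · have he : ω' e = false := by simpa [orientationArcs] using he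
    -- Edges of rank below `e` and pairs of `A ∪ B` are two-way here and cannot cross the boundary
    -- of `S`, and no arc leaves `S`. The arcs from `Sᶜ` to `S` thus form a cocycle with least edge
    -- `e`.
    set S : Set V(G) := {x | o.Reach (A ∪ B) (Prod.swap ⁻¹' (A ∪ B))
      ({a | r a.1 < r e} ∪ orientationArcs ω') (o.tail e) x} with hS
    have hstep : ∀ a : G.Arc, (r a.1 < r e ∨ ω' a.1 = a.2) → o.src a ∈ S → o.tgt a ∈ S :=
      fun a ha h => ReflTransGen.tail h (.inl ⟨a, ha, rfl, rfl⟩)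
    have htail : o.tail e ∈ S := ReflTransGen.refl
    refine hlt {j | ∃ a ∈ orientationArcs ω', a.1 = j ∧ o.src a ∈ Sᶜ ∧ o.tgt a ∉ Sᶜ} e ?_ ?_ he
      (.inr ⟨hcoc, _, ⟨⟨e, ?_⟩, Sᶜ, rfl, ?_, ?_, ?_⟩, rfl⟩)
    · exact ⟨(e, false), he, rfl, hreach, by simpa [tgt] using htail⟩
    · rintro _ ⟨⟨j, b⟩, ha, rfl, h₁, h₂⟩
      by_contra hj
      refine h₁ ?_
      have := hstep (j, !b) (.inl (not_le.1 hj))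
      rw [o.src_not, o.tgt_not] at this
      exact this (not_not.1 h₂)
    · exact ⟨(e, false), he, rfl, hreach, by simpa [tgt] using htail⟩
    · rintro a ha ⟨h₁, h₂⟩
      exact h₂ (hstep a (.inr ha) (not_not.1 h₁))
    · rintro p hp ⟨h₁, h₂⟩
      exact h₂ (ReflTransGen.tail (not_not.1 h₁) (.inr (.inl hp)))
    · rintro p hp ⟨h₁, h₂⟩
      exact h₁ (ReflTransGen.tail (not_not.1 h₂) (.inr (.inr hp)))

/-! ### Uniqueness, by circulations and potentials -/

/-- `1` for the conventional direction and `0` for the other one. -/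
def indicator (b : Bool) : ℤ := if b then 1 else 0

/-- The change is a circulation, expressed as orthogonality to all coboundaries; along the cycle the
sum telescopes. -/
theorem sum_cycle [Fintype E(G)] {n : ℕ} {c : Fin (n + 1) → G.Arc} (hc : o.IsCycle c)
    {ω : G.Orientation} (hω : ∀ i, c i ∈ orientationArcs ω) (q : V(G) → ℤ) :
    ∑ e, (indicator (reverse ω (Set.range fun i => (c i).1) e) - indicator (ω e)) *
      (q (o.head e) - q (o.tail e)) = 0 := by
  classical
  set X := Set.range fun i => (c i).1 with hX
  have hzero : ∀ e, e ∉ X → (indicator (reverse ω X e) - indicator (ω e)) *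
      (q (o.head e) - q (o.tail e)) = 0 := by
    intro e he
    simp [reverse, he]
  have hval : ∀ i, (indicator (reverse ω X (c i).1) - indicator (ω (c i).1)) *
      (q (o.head (c i).1) - q (o.tail (c i).1)) = q (o.src (c i)) - q (o.src (c (i + 1))) := by
    intro i
    have hi : ω (c i).1 = (c i).2 := hω i
    have hmem : (c i).1 ∈ X := ⟨i, rfl⟩
    rw [← hc.1, reverse, if_pos hmem, hi]
    cases h : (c i).2 <;> simp [indicator, src, tgt, h]
  calc ∑ e, (indicator (reverse ω X e) - indicator (ω e)) * (q (o.head e) - q (o.tail e))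
      = ∑ e ∈ Finset.univ.image fun i => (c i).1,
          (indicator (reverse ω X e) - indicator (ω e)) * (q (o.head e) - q (o.tail e)) := by
        refine (Finset.sum_subset (Finset.subset_univ _) fun e _ he => hzero e ?_).symm
        simpa [hX] using he
    _ = ∑ i, (q (o.src (c i)) - q (o.src (c (i + 1)))) := by
        rw [Finset.sum_image fun i _ j _ h => hc.2.2 h]
        exact Finset.sum_congr rfl fun i _ => hval i
    _ = 0 := by
        rw [Finset.sum_sub_distrib, sub_eq_zero]
        exact (Equiv.sum_comp (Equiv.addRight (1 : Fin (n + 1))) fun i => q (o.src (c i))).symm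

/-- Orientations related by reversals differ by an integral circulation and the coboundary of an
integral potential that is constant along `A` and `B`. -/
theorem exists_circulation_potential [Fintype E(G)] {cyc coc : Prop} {A B : Set (V(G) × V(G))}
    {ω ω' : G.Orientation} (h : ReflTransGen (o.Reversal cyc coc A B) ω ω') :
    ∃ (z : E(G) → ℤ) (p : V(G) → ℤ), (¬ cyc → z = 0) ∧ (¬ coc → p = 0) ∧
      (∀ q : V(G) → ℤ, ∑ e, z e * (q (o.head e) - q (o.tail e)) = 0) ∧
      (∀ x ∈ A ∪ B, p x.1 = p x.2) ∧
      ∀ e, indicator (ω' e) - indicator (ω e) = z e + (p (o.head e) - p (o.tail e)) := by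
  classical
  induction h with
  | refl => exact ⟨0, 0, by simp⟩
  | @tail ω₁ ω₂ _ hrev ih =>
    obtain ⟨z, p, hz, hp, hcirc, hAB, hdiff⟩ := ih
    rcases hrev with ⟨hcyc, X, ⟨n, c, hc, hω, rfl⟩, rfl⟩ | ⟨hcoc, X, ⟨-, U, hX, hU, h₁, h₂⟩, rfl⟩
    · refine ⟨fun e => z e + (indicator (reverse ω₁ (Set.range fun i => (c i).1) e) -
        indicator (ω₁ e)), p, fun h => (h hcyc).elim, hp, fun q => ?_, hAB, fun e => ?_⟩
      · simp only [add_mul, Finset.sum_add_distrib, hcirc, o.sum_cycle hc hω, add_zero]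
      · linarith [hdiff e]
    -- Reversing the cut adds the coboundary of the indicator function of `U`.
    · refine ⟨z, fun x => p x + if x ∈ U then 1 else 0, hz, fun h => (h hcoc).elim, hcirc,
        fun x hx => ?_, fun e => ?_⟩
      · have := h₁ x hx
        have := h₂ x hx
        have : x.1 ∈ U ↔ x.2 ∈ U := by tauto
        simp [hAB x hx, this]
      · have hm : e ∈ X ↔ o.src (e, ω₁ e) ∈ U ∧ o.tgt (e, ω₁ e) ∉ U := by
          rw [hX]
          constructor
          · rintro ⟨⟨j, b⟩, hb, rfl, h⟩
            obtain rfl : ω₁ j = b := hb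
            exact h
          · exact fun h => ⟨(e, ω₁ e), rfl, rfl, h⟩
        have hn := hU (e, ω₁ e) rfl
        have he := hdiff e
        rw [reverse]
        cases hb : ω₁ e <;> by_cases ht : o.tail e ∈ U <;> by_cases hh : o.head e ∈ U <;>
          simp [hb, src, tgt, ht, hh] at hm hn <;> simp [hm, ht, hh, indicator, hb] at he ⊢ <;>
          linarith

/-- In the decomposition of a `{-1, 0, 1}`-valued function as a circulation plus a coboundary, the
two summands have disjoint supports. -/
theorem circulation_eq_zero_or_coboundary_eq_zero [Fintype E(G)] {x z : E(G) → ℤ} {p : V(G) → ℤ}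
    (hx : ∀ e, |x e| ≤ 1) (hz : ∀ q : V(G) → ℤ, ∑ e, z e * (q (o.head e) - q (o.tail e)) = 0)
    (h : ∀ e, x e = z e + (p (o.head e) - p (o.tail e))) (e : E(G)) :
    z e = 0 ∨ p (o.head e) - p (o.tail e) = 0 := by
  classical
  by_contra! hne
  set t := max (p (o.head e)) (p (o.tail e)) with ht
  -- Test the circulation against a superlevel set of `p` that separates the ends of `e`. On an edge
  -- crossing its boundary, `p` changes by at least 1 in the direction of `q`, so `|x| ≤ 1` forces
  -- `z` to be zero or of opposite sign. All terms are nonpositive with sum zero, hence zero.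
  set q : V(G) → ℤ := fun v => if t ≤ p v then 1 else 0 with hq
  have hle : ∀ j ∈ Finset.univ, z j * (q (o.head j) - q (o.tail j)) ≤ 0 := by
    intro j _
    have hj := abs_le.1 (hx j)
    have := h j
    simp only [hq]
    split_ifs <;> simp <;> lia
  have := (Finset.sum_eq_zero_iff_of_nonpos hle).1 (hz q) e (Finset.mem_univ e)
  rcases mul_eq_zero.1 this with h' | h'
  · exact hne.1 h'
  · have hne2 := hne.2
    simp only [hq] at h'
    split_ifs at h' <;> simp at h' <;> lia

theorem indicator_sub_le (b c : Bool) : |indicator b - indicator c| ≤ 1 := by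
  cases b <;> cases c <;> simp [indicator]

/-- In the class of a reduced orientation `ω`, no orientation has the conventional direction at the
first edge where it differs from `ω`. -/
theorem not_exists_first_difference [Fintype E(G)] {r : E(G) → ℕ} (hr : r.Injective)
    {cyc coc : Prop} {A B : Set (V(G) × V(G))} {ω ω' : G.Orientation}
    (h : ReflTransGen (o.Reversal cyc coc A B) ω ω')
    (hω : o.IsReduced r cyc coc A B (orientationArcs ω)) (e : E(G))
    (he : ω e = false) (he' : ω' e = true) (hlt : ∀ j, r j < r e → ω j = ω' j) : False := by
  classical
  obtain ⟨z, p, hz, hp, hcirc, hAB, hdiff⟩ := o.exists_circulation_potential h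
  have hdisj := o.circulation_eq_zero_or_coboundary_eq_zero
    (fun e => indicator_sub_le (ω' e) (ω e)) hcirc hdiff
  have hbounds : ∀ j, (ω j = true → indicator (ω' j) - indicator (ω j) ≤ 0) ∧
      (ω j = false → 0 ≤ indicator (ω' j) - indicator (ω j)) := by
    intro j
    cases ω j <;> cases ω' j <;> simp [indicator]
  have hzero : ∀ j, r j < r e → indicator (ω' j) - indicator (ω j) = 0 := fun j hj => by
    rw [hlt j hj, sub_self]
  have hone : indicator (ω' e) - indicator (ω e) = 1 := by simp [indicator, he, he']
  have hde := hdiff e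
  rcases hdisj e with h0 | h0
  · have hcoc : coc := by
      by_contra hcoc
      simp [hp hcoc] at hde
      lia
    have hreach := hω.2 hcoc e (by simp [orientationArcs, he])
    -- Here `p` rises by 1 from tail to head of `e`. Yet it is constant along edges of smaller rank
    -- and along pairs, and does not increase along arcs of `ω`, so the walk given by reducedness is
    -- impossible.
    have hmono : ∀ x, o.Reach (A ∪ B) (Prod.swap ⁻¹' (A ∪ B))
        ({a | r a.1 < r e} ∪ orientationArcs ω) (o.tail e) x → p x ≤ p (o.tail e) := by
      intro x hx
      induction hx with
      | refl => exact le_rfl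
      | tail _ hbc ih =>
        refine le_trans ?_ ih
        rcases hbc with ⟨⟨j, b⟩, hj, rfl, rfl⟩ | hbc | hbc
        · have hdj := hdiff j
          rcases hj with hj | hj
          · have hj' := hzero j hj
            rcases hdisj j with h | h <;> cases b <;> simp [src, tgt] <;> lia
          · obtain rfl : ω j = b := hj
            have hb := hbounds j
            rcases hdisj j with h | h <;> cases hbj : ω j <;> simp [hbj, src, tgt] at hb ⊢ <;> lia
        · exact (hAB _ hbc).ge
        · exact (hAB _ hbc).le
    have := hmono _ hreach
    lia
  · have hcyc : cyc := by
      by_contra hcyc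
      simp [hz hcyc] at hde
      lia
    have hreach := hω.1 hcyc e he
    set S : Set V(G) := {x | o.Reach ∅ ∅ (orientationArcs ω ∩ {a | r e < r a.1}) (o.tail e) x}
      with hS
    have hstep : ∀ a : G.Arc, ω a.1 = a.2 → r e < r a.1 → o.src a ∈ S → o.tgt a ∈ S :=
      fun a ha hra h => ReflTransGen.tail h (.inl ⟨a, ⟨ha, hra⟩, rfl, rfl⟩)
    have htail : o.tail e ∈ S := ReflTransGen.refl
    have hhead : o.head e ∉ S := hreach
    have hsum := hcirc fun x => if x ∈ S then 1 else 0
    -- Here `z e = 1`, and `e` leaves `S`. Edges of smaller rank have `z = 0`. Those of larger rank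
    -- crossing the boundary are directed into `S` by `ω`, and `z` can only cancel them, so no term
    -- is positive.
    have hneg : ∑ j, z j * ((if o.head j ∈ S then 1 else 0) - if o.tail j ∈ S then 1 else 0) <
        ∑ j : E(G), (0 : ℤ) := by
      refine Finset.sum_lt_sum (fun j _ => ?_) ⟨e, Finset.mem_univ e, ?_⟩
      · have hdj := hdiff j
        rcases lt_trichotomy (r j) (r e) with hj | hj | hj
        · have hj' := hzero j hj
          have : z j = 0 := by rcases hdisj j with h | h <;> lia
          simp [this]
        · obtain rfl := hr hj
          simp [htail, hhead]
          lia
        · have hb := hbounds j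
          have hs := hstep (j, ω j) rfl hj
          have hdj' := hdisj j
          cases hbj : ω j
          · have hb := hb.2 hbj
            have hs : o.head j ∈ S → o.tail j ∈ S := by rwa [hbj] at hs
            have hzj : 0 ≤ z j := by lia
            by_cases hh : o.head j ∈ S
            · simp [hh, hs hh]
            · by_cases ht : o.tail j ∈ S
              · simpa [hh, ht] using hzj
              · simp [hh, ht]
          · have hb := hb.1 hbj
            have hs : o.tail j ∈ S → o.head j ∈ S := by rwa [hbj] at hs
            have hzj : z j ≤ 0 := by lia
            by_cases ht : o.tail j ∈ S
            · simp [ht, hs ht]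
            · by_cases hh : o.head j ∈ S
              · simpa [hh, ht] using hzj
              · simp [hh, ht]
      · simp [htail, hhead]
        lia
    rw [hsum, Finset.sum_const_zero] at hneg
    exact hneg.false

theorem repeated_eqv_symm {X : Type*} {R : X → X → Prop} (hR : ∀ {x y}, R x y → R y x) {x y : X}
    (h : ReflTransGen R x y) : ReflTransGen R y x :=
  (repeated R hR).symm h

theorem eq_of_isReduced [Finite E(G)] {r : E(G) → ℕ} (hr : r.Injective)
    {cyc coc : Prop} {A B : Set (V(G) × V(G))} {ω ω' : G.Orientation}
    (h : ReflTransGen (o.Reversal cyc coc A B) ω ω')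
    (hω : o.IsReduced r cyc coc A B (orientationArcs ω))
    (hω' : o.IsReduced r cyc coc A B (orientationArcs ω')) : ω = ω' := by
  have := Fintype.ofFinite E(G)
  by_contra hne
  obtain ⟨e, he, hmin⟩ := (InvImage.wf r Nat.lt_wfRel.wf).has_min {e | ω e ≠ ω' e}
    (Function.ne_iff.1 hne)
  have hlt : ∀ j, r j < r e → ω j = ω' j := fun j hj => by_contra fun h => hmin j h hj
  have he : ω e ≠ ω' e := he
  cases h₁ : ω e <;> cases h₂ : ω' e
  · exact he (h₁.trans h₂.symm)
  · exact o.not_exists_first_difference hr h hω e h₁ h₂ hlt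
  · exact o.not_exists_first_difference hr (repeated_eqv_symm o.reversal_symm h) hω' e h₂ h₁
      fun j hj => (hlt j hj).symm
  · exact he (h₁.trans h₂.symm)

/-- Every class of valid orientations contains exactly one reduced orientation. -/
theorem numValidClasses_eq [Finite E(G)] {r : E(G) → ℕ} (hr : r.Injective) (cyc coc : Prop)
    (A B : Set (V(G) × V(G))) :
    o.numValidClasses A B (repeated (o.Reversal cyc coc A B) o.reversal_symm) =
      Nat.card {ω : G.Orientation // o.IsValid A B (orientationArcs ω) ∧
        o.IsReduced r cyc coc A B (orientationArcs ω)} := by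
  symm
  refine Nat.card_eq_of_bijective (fun ω => Quotient.mk _ ⟨ω.1, ω.2.1⟩) ⟨fun ω ω' h => ?_, ?_⟩
  · exact Subtype.ext (o.eq_of_isReduced hr (Quotient.exact h) ω.2.2 ω'.2.2)
  · refine Quotient.ind fun ω => ?_
    obtain ⟨ω', h, hred⟩ := o.exists_isReduced hr cyc coc A B ω.1
    exact ⟨⟨ω', o.isValid_of_reversals h ω.2, hred⟩,
      Quotient.sound (repeated_eqv_symm o.reversal_symm h)⟩

/-! ### Reduced subgraphs: forests and `(A, B)`-connected subgraphs -/

theorem exists_arc_iff_exists_isLink (F : Set E(G)) (u v : V(G)) :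
    (∃ a ∈ subgraphArcs F, o.src a = u ∧ o.tgt a = v) ↔ ∃ e ∈ F, G.IsLink e u v := by
  constructor
  · rintro ⟨⟨e, b⟩, he, rfl, rfl⟩
    refine ⟨e, he, ?_⟩
    cases b
    · exact (o.isLink e).symm
    · exact o.isLink e
  · rintro ⟨e, he, h⟩
    rcases h.eq_and_eq_or_eq_and_eq (o.isLink e) with ⟨h₁, h₂⟩ | ⟨h₁, h₂⟩
    · exact ⟨(e, true), he, Subtype.ext h₁.symm, Subtype.ext h₂.symm⟩
    · exact ⟨(e, false), he, Subtype.ext h₁.symm, Subtype.ext h₂.symm⟩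

theorem step_symm {C : Set (V(G) × V(G))} {F : Set E(G)} {u v : V(G)}
    (h : o.Step C (Prod.swap ⁻¹' C) (subgraphArcs F) u v) :
    o.Step C (Prod.swap ⁻¹' C) (subgraphArcs F) v u := by
  rcases h with ⟨⟨e, b⟩, he, rfl, rfl⟩ | h | h
  · exact .inl ⟨(e, !b), he, o.src_not e b, o.tgt_not e b⟩
  · exact .inr (.inr h)
  · exact .inr (.inl h)

theorem reach_symm {C : Set (V(G) × V(G))} {F : Set E(G)} {u v : V(G)}
    (h : o.Reach C (Prod.swap ⁻¹' C) (subgraphArcs F) u v) :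
    o.Reach C (Prod.swap ⁻¹' C) (subgraphArcs F) v u :=
  repeated_eqv_symm o.step_symm h

theorem reflTransGen_adjAdd_iff (A B : Set (V(G) × V(G))) (F : Set E(G)) (u v : V(G)) :
    ReflTransGen (AdjAdd A B F) u v ↔
      o.Reach (A ∪ B) (Prod.swap ⁻¹' (A ∪ B)) (subgraphArcs F) u v := by
  have : AdjAdd A B F = o.Step (A ∪ B) (Prod.swap ⁻¹' (A ∪ B)) (subgraphArcs F) := by
    ext u v
    rw [AdjAdd, Step, o.exists_arc_iff_exists_isLink]
    rfl
  rw [this, Reach]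

/-- In any cycle, the other edges join the ends of the edge of least rank and all have larger rank.
-/
theorem isForest_iff {r : E(G) → ℕ} (hr : r.Injective) (F : Set E(G)) :
    o.IsForest F ↔ ∀ e, (e, false) ∈ subgraphArcs F →
      ¬ o.Reach ∅ ∅ (subgraphArcs F ∩ {a | r e < r a.1}) (o.tail e) (o.head e) := by
  constructor
  · intro hF e he hreach
    obtain ⟨n, c, hc, -, hcD⟩ := o.exists_isCycle_of_reach (a := (e, false))
      (D := subgraphArcs F ∩ {a | r e < r a.1})
      (by rintro ⟨j, b⟩ ⟨-, hj⟩ rfl; exact Nat.lt_irrefl _ hj) hreach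
    refine hF ⟨n, c, hc, fun i => ?_⟩
    rcases hcD i with h | h
    · rw [h]; exact he
    · exact h.1
  · rintro h ⟨n, c, hc, hcF⟩
    obtain ⟨i, hi⟩ := Finite.exists_min fun i => r (c i).1
    have hreach : o.Reach ∅ ∅ (subgraphArcs (F ∩ {e | r (c i).1 < r e}))
        (o.tgt (c i)) (o.src (c i)) := by
      refine reflTransGen_mono (o.step_mono le_rfl ?_) (o.reach_of_isCycle hc ∅ ∅ i)
      rintro _ ⟨j, hj, rfl⟩
      exact ⟨hcF j, lt_of_le_of_ne (hi j) fun h => hj (hc.2.2 (hr h)).symm⟩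
    refine h (c i).1 (hcF i) ?_
    change o.Reach ∅ ∅ (subgraphArcs (F ∩ {e | r (c i).1 < r e})) _ _
    cases hb : (c i).2
    · simpa [src, tgt, hb] using hreach
    · refine o.reach_symm (C := ∅) ?_
      simpa [src, tgt, hb] using hreach

/-- Starting from all edges, those outside `F` can be removed in order of decreasing rank, each
being bypassed by `F`, the pairs and edges of smaller rank. -/
theorem isABConnected_iff [Finite E(G)] (r : E(G) → ℕ) (A B : Set (V(G) × V(G)))
    (F : Set E(G)) :
    IsABConnected A B F ↔ ∀ e, (e, true) ∉ subgraphArcs F →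
      o.Reach (A ∪ B) (Prod.swap ⁻¹' (A ∪ B)) ({a | r a.1 < r e} ∪ subgraphArcs F)
        (o.tail e) (o.head e) := by
  simp only [IsABConnected, o.reflTransGen_adjAdd_iff]
  constructor
  · intro h e _
    refine reflTransGen_mono (o.step_mono le_rfl Set.subset_union_right) ((h _ _).2 ?_)
    exact .single (.inl ⟨(e, true), Set.mem_univ _, rfl, rfl⟩)
  · intro h u v
    refine ⟨reflTransGen_mono (o.step_mono le_rfl fun a _ => Set.mem_univ _), fun huv => ?_⟩
    obtain ⟨k, hk⟩ : ∃ k, ∀ e, r e < k := by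
      obtain ⟨k, hk⟩ := (Set.finite_range r).bddAbove
      exact ⟨k + 1, fun e => Nat.lt_succ_of_le (hk ⟨e, rfl⟩)⟩
    have key : ∀ n, o.Reach (A ∪ B) (Prod.swap ⁻¹' (A ∪ B))
        (subgraphArcs ({e | r e < n} ∪ F)) u v →
        o.Reach (A ∪ B) (Prod.swap ⁻¹' (A ∪ B)) (subgraphArcs F) u v := by
      intro n
      induction n with
      | zero => simp
      | succ n ih =>
        refine fun huv => ih ?_
        refine ReflTransGen.trans_induction_on (motive := fun {x y} _ => o.Reach (A ∪ B)
          (Prod.swap ⁻¹' (A ∪ B)) (subgraphArcs ({e | r e < n} ∪ F)) x y) huv (fun _ => .refl) ?_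
          (fun _ _ => .trans)
        rintro x y (⟨⟨e, b⟩, he, rfl, rfl⟩ | hxy)
        · by_cases he' : e ∈ {e | r e < n} ∪ F
          · exact .single (.inl ⟨(e, b), he', rfl, rfl⟩)
          · have hF : e ∉ F := fun h => he' (.inr h)
            have hn : ¬ r e < n := fun h => he' (.inl h)
            have hn' : r e < n + 1 := he.resolve_right hF
            obtain rfl : r e = n := by lia
            have hreach : o.Reach (A ∪ B) (Prod.swap ⁻¹' (A ∪ B))
              (subgraphArcs ({j | r j < r e} ∪ F)) (o.tail e) (o.head e) := h e hF
            cases b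
            · exact o.reach_symm hreach
            · exact hreach
        · exact .single (.inr hxy)
    refine key k (reflTransGen_mono (o.step_mono le_rfl ?_) huv)
    exact fun a _ => .inl (hk a.1)

/-! ### The three counts and the case without pairs -/

theorem numValidClasses_reversal_eq [Finite E(G)] (cyc coc : Prop) (A B : Set (V(G) × V(G))) :
    o.numValidClasses A B (repeated (o.Reversal cyc coc A B) o.reversal_symm) =
      Nat.card {F : Set E(G) // o.IsValid A B (subgraphArcs F) ∧
        (cyc → o.IsForest F) ∧ (coc → IsABConnected A B F)} := by
  obtain ⟨r, hr⟩ := Countable.exists_injective_nat E(G)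
  rw [o.numValidClasses_eq hr, o.card_reduced_orientation_eq hr]
  simp only [o.isForest_iff hr, o.isABConnected_iff r]
  rfl

theorem cycleEquiv_eq (A B : Set (V(G) × V(G))) :
    o.cycleEquiv = repeated (o.Reversal True False A B) o.reversal_symm := by
  have : o.CycleReversal = o.Reversal True False A B := by ext; simp [Reversal]
  ext ω ω'
  change ReflTransGen _ _ _ ↔ ReflTransGen _ _ _
  rw [this]

theorem cocycleEquiv_eq (A B : Set (V(G) × V(G))) :
    o.cocycleEquiv A B = repeated (o.Reversal False True A B) o.reversal_symm := by
  have : o.CocycleReversal A B = o.Reversal False True A B := by ext; simp [Reversal]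
  ext ω ω'
  change ReflTransGen _ _ _ ↔ ReflTransGen _ _ _
  rw [this]

theorem cycleCocycleEquiv_eq (A B : Set (V(G) × V(G))) :
    o.cycleCocycleEquiv A B = repeated (o.Reversal True True A B) o.reversal_symm := by
  have : o.CycleCocycleReversal A B = o.Reversal True True A B := by
    ext; simp [Reversal, CycleCocycleReversal]
  ext ω ω'
  change ReflTransGen _ _ _ ↔ ReflTransGen _ _ _
  rw [this]

theorem isValid_empty (D : Set G.Arc) : o.IsValid ∅ ∅ D :=
  ⟨fun _ _ h => h.elim, fun _ _ h => h.elim⟩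

theorem numValidClasses_empty (s : Setoid G.Orientation) :
    o.numValidClasses ∅ ∅ s = Nat.card (Quotient s) :=
  Nat.card_congr (Quotient.congr (Equiv.subtypeUnivEquiv fun _ => o.isValid_empty _)
    fun _ _ => Iff.rfl)

end RefOrientation

theorem isABConnected_empty_iff {α β : Type*} {G : Graph α β}
    (hG : IsConnectedSubgraph (Set.univ : Set E(G))) (F : Set E(G)) :
    IsABConnected ∅ ∅ F ↔ IsConnectedSubgraph F := by
  have hadj (F : Set E(G)) :
      AdjAdd ∅ ∅ F = fun x y : V(G) => ∃ e ∈ F, G.IsLink e x y := by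
    ext
    simp [AdjAdd]
  simp only [IsABConnected, hadj]
  exact ⟨fun h => ⟨hG.1, fun u v => (h u v).2 (hG.2 u v)⟩,
    fun h u v => iff_of_true (h.2 u v) (hG.2 u v)⟩

end Graph

theorem corollary4 {α β : Type*} (G : Graph α β) [Finite V(G)] [Finite E(G)]
    (o : G.RefOrientation) :
    (∀ A B : Set (V(G) × V(G)),
      o.numValidClasses A B o.cycleEquiv =
          Nat.card {F : Set E(G) // o.IsValid A B (Graph.subgraphArcs F) ∧ o.IsForest F} ∧
      o.numValidClasses A B (o.cocycleEquiv A B) =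
          Nat.card {F : Set E(G) // o.IsValid A B (Graph.subgraphArcs F) ∧
            Graph.IsABConnected A B F} ∧
      o.numValidClasses A B (o.cycleCocycleEquiv A B) =
          Nat.card {F : Set E(G) // o.IsValid A B (Graph.subgraphArcs F) ∧
            Graph.IsABConnected A B F ∧ o.IsForest F}) ∧
    Nat.card (Quotient o.cycleEquiv) = Nat.card {F : Set E(G) // o.IsForest F} ∧
    (Graph.IsConnectedSubgraph (Set.univ : Set E(G)) →
      Nat.card (Quotient (o.cocycleEquiv ∅ ∅)) =
          Nat.card {F : Set E(G) // Graph.IsConnectedSubgraph F} ∧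
      Nat.card (Quotient (o.cycleCocycleEquiv ∅ ∅)) =
          Nat.card {F : Set E(G) // Graph.IsConnectedSubgraph F ∧ o.IsForest F}) := by
  have main : ∀ A B : Set (V(G) × V(G)),
      o.numValidClasses A B o.cycleEquiv =
          Nat.card {F : Set E(G) // o.IsValid A B (Graph.subgraphArcs F) ∧ o.IsForest F} ∧
      o.numValidClasses A B (o.cocycleEquiv A B) =
          Nat.card {F : Set E(G) // o.IsValid A B (Graph.subgraphArcs F) ∧
            Graph.IsABConnected A B F} ∧
      o.numValidClasses A B (o.cycleCocycleEquiv A B) =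
          Nat.card {F : Set E(G) // o.IsValid A B (Graph.subgraphArcs F) ∧
            Graph.IsABConnected A B F ∧ o.IsForest F} := by
    intro A B
    rw [o.cycleEquiv_eq A B, o.cocycleEquiv_eq, o.cycleCocycleEquiv_eq,
      o.numValidClasses_reversal_eq, o.numValidClasses_reversal_eq, o.numValidClasses_reversal_eq]
    simp [and_comm]
  obtain ⟨h₁, h₂, h₃⟩ := main ∅ ∅
  simp only [o.numValidClasses_empty, o.isValid_empty, true_and] at h₁ h₂ h₃
  refine ⟨main, h₁, fun hG => ?_⟩
  simp only [Graph.isABConnected_empty_iff hG] at h₂ h₃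
  exact ⟨h₂, h₃⟩
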